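/- Let $k$ be a field, $N\ge 0$ an integer and $q\in k$ with $q\neq 0$, $q^2\neq 1$, $q^2\ne -1$; put $\lambda=q-q^{-1}$. Let $R$ be the Drinfeld--Jimbo matrix of $GL_q(N)$, $$R^{i_1i_2}_{j_1j_2}=\delta^{i_1}_{j_1}\delta^{i_2}_{j_2}\bigl(1+(q-1)\delta^{i_1i_2}\bigr)+(q-q^{-1})\,\delta^{i_1}_{j_2}\delta^{i_2}_{j_1}\Theta_{i_1i_2},\qquad \Theta_{ij}=1 \text{ if } i>j,\ \Theta_{ij}=0 \text{ if } i\le j,$$ (upper indices label rows, lower indices label columns), let $P$ be the permutation matrix and $\hat R=PR$. For an $N\times N$ matrix $X$ over an algebra let $X_2=1\otimes X$, and let $\mathrm{Tr}_q(X)=\mathrm{Tr}(D^{-1}X)$ with $(D^{-1})^i_j=q^{2(N-i)+1}\delta^i_j$. Let $\mathcal D$ be the associative unital $k$-algebra generated by the entries of $N\times N$ matrices $\omega$, $J$, $L$, subject to $$\omega_2\hat R^{-1}\omega_2\hat R=-\hat R^{-1}\omega_2\hat R^{-1}\omega_2,\qquad \omega_2\hat RL_2\hat R=\hat RL_2\hat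 R\,\omega_2,\qquad \omega_2\hat RJ_2\hat R+\hat RJ_2\hat R\,\omega_2=-\hat R,$$ $$L_2\hat RL_2\hat R=\hat RL_2\hat RL_2,\qquad J_2\hat RL_2\hat R=\hat RL_2\hat RJ_2,\qquad J_2\hat RJ_2\hat R=-\hat R^{-1}J_2\hat RJ_2,$$ together with the entries of two-sided inverses of the matrices $L$ and $W:=1+\lambda\,\omega J$. (Hence every identity below holds in every $k$-algebra that contains matrices $\omega,J,L$ with these relations and with $L$ and $W$ invertible.) Put $\overline W=1+\lambda J\omega$ and $$Q=\mathrm{Tr}_q\Bigl(\tfrac1\lambda\,\omega(L-1)-\omega L(\omega J)(1+\lambda\omega J)^{-1}\Bigr),\qquad Q^*=\mathrm{Tr}_q\Bigl(\tfrac1\lambda\,J(L^{-1}-1)+JL^{-1}J\omega\Bigr),$$ $$\Delta=QQ^*+Q^*Q,\qquad \Theta^*=JL^{-1}\overline W,\qquad U=WL^{-1}\overline W .$$ Then the following hold in $\mathcal D$. 1. $\displaystyle \Delta=\lambda^{-2}\,\mathrm{Tr}_q\bigl(L-2+L^{-1}\overline W-\lambda JL^{-1}\overline W\omega\bigr)$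 and $\displaystyle \Delta=\lambda^{-2}\,\mathrm{Tr}_q\bigl(L+q^{2N}U-2\bigr)$. 2. $[Q,\Delta]=0$ and $[Q^*,\Delta]=0$. 3. $U^i_j=-q^{-2N}\bigl(\mathrm{Tr}_q(\Theta^*)\,\omega^i_j+\omega^i_j\,\mathrm{Tr}_q(\Theta^*)\bigr)$ for all $i,j$, and $U$ satisfies the reflection equation $$\hat R^{-1}U_2\hat R^{-1}U_2=U_2\hat R^{-1}U_2\hat R^{-1}.$$ 4. $\hat RU_2\hat R^{-1}\omega_2=\omega_2\hat R^{-1}U_2\hat R$ and $\hat R^{-1}U_2\hat RJ_2=J_2\hat RU_2\hat R^{-1}$. -/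

import Mathlib

open scoped Kronecker

noncomputable section

namespace QuantumGL

variable {k : Type*} [Field k]

/-- `λ = q - q⁻¹`. -/
def lam (q : k) : k := q - q⁻¹

/-- The Drinfeld-Jimbo matrix of `GL_q(N)`. The row index is the pair of upper indices
`(i₁, i₂)`, the column index is the pair of lower indices `(j₁, j₂)`:
`R^{i₁ i₂}_{j₁ j₂} = δ^{i₁}_{j₁} δ^{i₂}_{j₂} (1 + (q - 1) δ^{i₁ i₂})
  + (q - q⁻¹) δ^{i₁}_{j₂} δ^{i₂}_{j₁} Θ_{i₁ i₂}`, with `Θ_{ij} = 1` if `i > j`, else `0`. -/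
def RMat (q : k) (N : ℕ) : Matrix (Fin N × Fin N) (Fin N × Fin N) k :=
  Matrix.of fun i j =>
    (if i.1 = j.1 ∧ i.2 = j.2 then 1 + (q - 1) * (if i.1 = i.2 then 1 else 0) else 0)
      + (q - q⁻¹) * (if i.1 = j.2 ∧ i.2 = j.1 then (if i.2 < i.1 then 1 else 0) else 0)

/-- The permutation matrix `P₁₂` of the two tensor factors. -/
def PMat (k : Type*) [Field k] (N : ℕ) : Matrix (Fin N × Fin N) (Fin N × Fin N) k :=
  Matrix.of fun i j => if i.1 = j.2 ∧ i.2 = j.1 then 1 else 0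

/-- `R̂ = P₁₂ R₁₂`. -/
def RHat (q : k) (N : ℕ) : Matrix (Fin N × Fin N) (Fin N × Fin N) k :=
  PMat k N * RMat q N

/-- The numerical matrix `D⁻¹ = diag(q^{2(N - i) + 1})`, `i = 1, …, N` (here `i = a + 1`
for `a : Fin N`, so the truncated subtraction is exact). -/
def DInv (q : k) (N : ℕ) : Matrix (Fin N) (Fin N) k :=
  Matrix.diagonal fun a => q ^ (2 * (N - (a.val + 1)) + 1)

section Algebra

variable (A : Type*) [Ring A] [Algebra k A]

/-- `R̂` as a matrix with entries in a `k`-algebra. -/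
def RA (q : k) (N : ℕ) : Matrix (Fin N × Fin N) (Fin N × Fin N) A :=
  (RHat q N).map (algebraMap k A)

/-- `R̂⁻¹` as a matrix with entries in a `k`-algebra. -/
def RAInv (q : k) (N : ℕ) : Matrix (Fin N × Fin N) (Fin N × Fin N) A :=
  ((RHat q N)⁻¹).map (algebraMap k A)

variable {A}

/-- `X₂ = 1 ⊗ X`: the matrix `X` acting in the second of two tensor factors. -/
def sp2 {N : ℕ} (X : Matrix (Fin N) (Fin N) A) :
    Matrix (Fin N × Fin N) (Fin N × Fin N) A :=
  (1 : Matrix (Fin N) (Fin N) A) ⊗ₖ X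

/-- The quantum trace `Tr_q(Y) = Tr(D⁻¹ Y)`. -/
def qTr (q : k) {N : ℕ} (Y : Matrix (Fin N) (Fin N) A) : A :=
  Matrix.trace ((DInv q N).map (algebraMap k A) * Y)

end Algebra

/-- Generators: the entries of the matrices `ω`, `J`, `L`, of `L⁻¹`, and of the inverse of
`W = 1 + λ ω J`, which enters the formula for the BRST operator. -/
inductive Gen (N : ℕ) : Type
  | omega (i j : Fin N)
  | J (i j : Fin N)
  | L (i j : Fin N)
  | Linv (i j : Fin N)
  | Winv (i j : Fin N)

section Free

variable (k) (N : ℕ)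

def freeOmega : Matrix (Fin N) (Fin N) (FreeAlgebra k (Gen N)) :=
  Matrix.of fun i j => FreeAlgebra.ι k (Gen.omega i j)

def freeJ : Matrix (Fin N) (Fin N) (FreeAlgebra k (Gen N)) :=
  Matrix.of fun i j => FreeAlgebra.ι k (Gen.J i j)

def freeL : Matrix (Fin N) (Fin N) (FreeAlgebra k (Gen N)) :=
  Matrix.of fun i j => FreeAlgebra.ι k (Gen.L i j)

def freeLinv : Matrix (Fin N) (Fin N) (FreeAlgebra k (Gen N)) :=
  Matrix.of fun i j => FreeAlgebra.ι k (Gen.Linv i j)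

def freeWinv : Matrix (Fin N) (Fin N) (FreeAlgebra k (Gen N)) :=
  Matrix.of fun i j => FreeAlgebra.ι k (Gen.Winv i j)

variable {k}

/-- `R̂` over the free algebra. -/
abbrev freeR (q : k) : Matrix (Fin N × Fin N) (Fin N × Fin N) (FreeAlgebra k (Gen N)) :=
  RA (FreeAlgebra k (Gen N)) q N

/-- `R̂⁻¹` over the free algebra. -/
abbrev freeRInv (q : k) : Matrix (Fin N × Fin N) (Fin N × Fin N) (FreeAlgebra k (Gen N)) :=
  RAInv (FreeAlgebra k (Gen N)) q N

end Free

/-- The defining relations, entry by entry: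
* `ω₂ R̂⁻¹ ω₂ R̂ = - R̂⁻¹ ω₂ R̂⁻¹ ω₂`, `ω₂ R̂ L₂ R̂ = R̂ L₂ R̂ ω₂`,
* `ω₂ R̂ J₂ R̂ + R̂ J₂ R̂ ω₂ = - R̂`, `L₂ R̂ L₂ R̂ = R̂ L₂ R̂ L₂`,
* `J₂ R̂ L₂ R̂ = R̂ L₂ R̂ J₂`, `J₂ R̂ J₂ R̂ = - R̂⁻¹ J₂ R̂ J₂`,
* `Linv` is the two-sided inverse of `L`, and `Winv` that of `1 + λ ω J`. -/
inductive Rel (q : k) (N : ℕ) : FreeAlgebra k (Gen N) → FreeAlgebra k (Gen N) → Prop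
  | omega_omega (a b : Fin N × Fin N) : Rel q N
      ((sp2 (freeOmega k N) * freeRInv N q * sp2 (freeOmega k N) * freeR N q) a b)
      ((-(freeRInv N q * sp2 (freeOmega k N) * freeRInv N q * sp2 (freeOmega k N))) a b)
  | omega_L (a b : Fin N × Fin N) : Rel q N
      ((sp2 (freeOmega k N) * freeR N q * sp2 (freeL k N) * freeR N q) a b)
      ((freeR N q * sp2 (freeL k N) * freeR N q * sp2 (freeOmega k N)) a b)
  | omega_J (a b : Fin N × Fin N) : Rel q N
      ((sp2 (freeOmega k N) * freeR N q * sp2 (freeJ k N) * freeR N q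
        + freeR N q * sp2 (freeJ k N) * freeR N q * sp2 (freeOmega k N)) a b)
      ((-freeR N q) a b)
  | L_L (a b : Fin N × Fin N) : Rel q N
      ((sp2 (freeL k N) * freeR N q * sp2 (freeL k N) * freeR N q) a b)
      ((freeR N q * sp2 (freeL k N) * freeR N q * sp2 (freeL k N)) a b)
  | J_L (a b : Fin N × Fin N) : Rel q N
      ((sp2 (freeJ k N) * freeR N q * sp2 (freeL k N) * freeR N q) a b)
      ((freeR N q * sp2 (freeL k N) * freeR N q * sp2 (freeJ k N)) a b)
  | J_J (a b : Fin N × Fin N) : Rel q N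
      ((sp2 (freeJ k N) * freeR N q * sp2 (freeJ k N) * freeR N q) a b)
      ((-(freeRInv N q * sp2 (freeJ k N) * freeR N q * sp2 (freeJ k N))) a b)
  | L_Linv (i j : Fin N) : Rel q N ((freeL k N * freeLinv k N) i j)
      ((1 : Matrix (Fin N) (Fin N) (FreeAlgebra k (Gen N))) i j)
  | Linv_L (i j : Fin N) : Rel q N ((freeLinv k N * freeL k N) i j)
      ((1 : Matrix (Fin N) (Fin N) (FreeAlgebra k (Gen N))) i j)
  | W_Winv (i j : Fin N) : Rel q N
      (((1 + lam q • (freeOmega k N * freeJ k N)) * freeWinv k N) i j)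
      ((1 : Matrix (Fin N) (Fin N) (FreeAlgebra k (Gen N))) i j)
  | Winv_W (i j : Fin N) : Rel q N
      ((freeWinv k N * (1 + lam q • (freeOmega k N * freeJ k N))) i j)
      ((1 : Matrix (Fin N) (Fin N) (FreeAlgebra k (Gen N))) i j)

/-- The algebra of differential forms `ω`, inner derivations `J` and vector fields `L` over
`U_q(gl(N))`, as the associative unital `k`-algebra presented by the relations above. It is
universal among `k`-algebras with matrices `ω`, `J`, `L` that obey these relations and in which
`L` and `1 + λ ω J` are invertible, so an identity that holds here holds in each of them, in
particular after adding the generators `T` of the quantum group. -/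
abbrev DiffAlg (q : k) (N : ℕ) : Type _ := RingQuot (Rel q N)

variable (q : k) (N : ℕ)

/-- The canonical map from the free algebra. -/
def toDiff : FreeAlgebra k (Gen N) →ₐ[k] DiffAlg q N := RingQuot.mkAlgHom k (Rel q N)

/-- The matrix `ω` of left-invariant 1-forms. -/
def omegaM : Matrix (Fin N) (Fin N) (DiffAlg q N) := (freeOmega k N).map (toDiff q N)

/-- The matrix `J` of inner derivations. -/
def JM : Matrix (Fin N) (Fin N) (DiffAlg q N) := (freeJ k N).map (toDiff q N)

/-- The matrix `L` of vector fields. -/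
def LM : Matrix (Fin N) (Fin N) (DiffAlg q N) := (freeL k N).map (toDiff q N)

/-- The matrix `L⁻¹`. -/
def LInvM : Matrix (Fin N) (Fin N) (DiffAlg q N) := (freeLinv k N).map (toDiff q N)

/-- `W = 1 + λ ω J`. -/
def WM : Matrix (Fin N) (Fin N) (DiffAlg q N) := 1 + lam q • (omegaM q N * JM q N)

/-- The matrix `W⁻¹ = (1 + λ ω J)⁻¹`. -/
def WInvM : Matrix (Fin N) (Fin N) (DiffAlg q N) := (freeWinv k N).map (toDiff q N)

/-- `W̄ = 1 + λ J ω`. -/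
def WBarM : Matrix (Fin N) (Fin N) (DiffAlg q N) := 1 + lam q • (JM q N * omegaM q N)

/-- The BRST operator
`Q = Tr_q (ω (L - 1) / λ - ω L (ω J) (1 + λ ω J)⁻¹)`. -/
def brst : DiffAlg q N :=
  qTr q ((lam q)⁻¹ • (omegaM q N * (LM q N - 1))
    - omegaM q N * LM q N * (omegaM q N * JM q N) * WInvM q N)

/-- The anti-BRST operator
`Q* = Tr_q (J (L⁻¹ - 1) / λ + J L⁻¹ J ω)`. -/
def antiBrst : DiffAlg q N :=
  qTr q ((lam q)⁻¹ • (JM q N * (LInvM q N - 1))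
    + JM q N * LInvM q N * JM q N * omegaM q N)

/-- The quantum Laplacian `Δ = Q Q* + Q* Q`. -/
def laplacian : DiffAlg q N := brst q N * antiBrst q N + antiBrst q N * brst q N

/-- `Θ* = J L⁻¹ (1 + λ J ω)`. -/
def ThetaStarM : Matrix (Fin N) (Fin N) (DiffAlg q N) := JM q N * LInvM q N * WBarM q N

/-- The current `U = W L⁻¹ W̄`. -/
def UM : Matrix (Fin N) (Fin N) (DiffAlg q N) := WM q N * LInvM q N * WBarM q N

end QuantumGL

end

open QuantumGL

/-! Put Θ = ωLW⁻¹ and Θ* = JL⁻¹W̄. Expanding WW⁻¹ = 1 and W̄ gives Q = λ⁻¹(Tr_q Θ − Tr_q ω) and Q* =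
λ⁻¹(Tr_q Θ* − Tr_q J), so everything reduces to anticommutators of four quantum traces.

These come from exchange relations for W, W̄, Θ, Θ* and U, derived as word identities from the
defining relations and the Hecke condition R̂ = R̂⁻¹ + λ. The relations for U in the last two items
are obtained directly at this level (`HeckeDiff.U_U`, `HeckeDiff.U_w`, `HeckeDiff.U_j`).

For the rest, take the quantum trace over the first tensor factor. Since R̂X₂R̂⁻¹ and R̂⁻¹X₂R̂ both
go to the scalar matrix Tr_q X (`ptr_conj`, `ptr_conj_inv`), an exchange relation of X₂ with Y₂
becomes an (anti)commutation rule of Tr_q X with the entries of Y.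

Each of the four traces squares to zero because q² ≠ −1, and the two traces in Q, and the two in Q*,
anticommute. Hence Q² = Q*² = 0, which makes Δ commute with both. In Δ all brackets are immediate
except {Tr_q ω, Tr_q Θ*}. Moving Tr_q ω through Θ*, or Tr_q Θ* through ω, evaluates it in two ways
and gives the two formulas for Δ. -/

namespace QuantumGL

/-- Elements of an algebra over `k` that satisfy the relations of `R̂`, `R̂⁻¹`, `ω₂`, `J₂`, `L₂`,
together with `W = 1 + c ω J`, `W̄ = 1 + c J ω` and the inverses of `L` and `W`. -/
structure HeckeDiff {k M : Type*} [Field k] [Ring M] [Algebra k M] (c : k)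
    (R r w j l li W Wb Wi : M) : Prop where
  R_r : R * r = 1
  r_R : r * R = 1
  hecke : R = r + c • 1
  w_w : w * r * w * R = -(r * w * r * w)
  w_l : w * R * l * R = R * l * R * w
  w_j : w * R * j * R + R * j * R * w = -R
  l_l : l * R * l * R = R * l * R * l
  j_l : j * R * l * R = R * l * R * j
  j_j : j * R * j * R = -(r * j * R * j)
  l_li : l * li = 1
  li_l : li * l = 1
  W_eq : W = 1 + c • (w * j)
  Wb_eq : Wb = 1 + c • (j * w)
  W_Wi : W * Wi = 1
  Wi_W : Wi * W = 1

/-! ### Exchange relations of `W` and `W̄` with `ω`, `J` and `L` -/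

namespace HeckeDiff

variable {k M : Type*} [Field k] [Ring M] [Algebra k M] {c : k}
  {R r w j l li W Wb Wi : M} (D : HeckeDiff c R r w j l li W Wb Wi)

include D

theorem R_r' (x : M) : R * (r * x) = x := by rw [← mul_assoc, D.R_r, one_mul]

theorem r_R' (x : M) : r * (R * x) = x := by rw [← mul_assoc, D.r_R, one_mul]

theorem r_r : r * r = 1 - c • r := by
  have h := D.r_R
  rw [D.hecke, mul_add, mul_smul_comm, mul_one] at h
  exact eq_sub_of_add_eq h

theorem r_r' (x : M) : r * (r * x) = x - c • (r * x) := by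
  rw [← mul_assoc, D.r_r, sub_mul, one_mul, smul_mul_assoc]

/-- Here and in the next three lemmas the new letter is pushed through the product in `W` or `W̄`.
The inhomogeneous term of the `ω`-`J` relation is compensated by the summand 1 in `W` or `W̄`,
thanks to the Hecke condition. -/
theorem W_w : R * W * R * w = w * r * W * R := by
  have h1 := D.w_w
  have h3 := D.w_j
  rw [D.W_eq]
  rw [D.hecke] at h1 h3 ⊢
  -- With `R` replaced by `r + c` and `r * r` reduced to `1 - c • r`, both sides expand into
  -- combinations of reduced words in `r`, `w`, `j`, which `module` compares.
  linear_combination (norm := skip) (-c) • ((r + c • 1) * (r + c • 1) * h1 * r * j * (r + c • 1))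
    + c • ((r + c • 1) * (r + c • 1) * r * w * r * h3)
  simp only [mul_add, add_mul, mul_sub, sub_mul, mul_neg, neg_mul, mul_smul_comm, smul_mul_assoc,
    mul_one, one_mul, mul_assoc, D.r_r, D.r_r']
  module

theorem Wb_w : R * Wb * r * w = w * R * Wb * R := by
  have h1 := D.w_w
  have h3 := D.w_j
  rw [D.Wb_eq]
  rw [D.hecke] at h1 h3 ⊢
  linear_combination (norm := skip) c • ((r + c • 1) * j * (r + c • 1) * h1)
    - c • (h3 * r * w * (r + c • 1))
  simp only [mul_add, add_mul, mul_sub, sub_mul, mul_neg, neg_mul, mul_smul_comm, smul_mul_assoc,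
    mul_one, one_mul, mul_assoc, D.r_r, D.r_r']
  module

theorem W_j : r * W * R * j = j * R * W * R := by
  have h6 := D.j_j
  have h3 := D.w_j
  rw [D.W_eq]
  rw [D.hecke] at h6 h3 ⊢
  linear_combination (norm := skip) c • (r * w * (r + c • 1) * h6)
    - c • (r * h3 * r * (r + c • 1) * j * (r + c • 1))
  simp only [mul_add, add_mul, mul_sub, sub_mul, mul_neg, neg_mul, mul_smul_comm, smul_mul_assoc,
    mul_one, one_mul, mul_assoc, D.r_r, D.r_r']
  module

theorem Wb_j : R * Wb * R * j = j * R * Wb * r := by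
  have h6 := D.j_j
  have h3 := D.w_j
  rw [D.Wb_eq]
  rw [D.hecke] at h6 h3 ⊢
  linear_combination (norm := skip) (-c) • ((r + c • 1) * (r + c • 1) * h6 * r * w * r)
    + c • ((r + c • 1) * (r + c • 1) * r * j * (r + c • 1) * r * h3 * r)
  simp only [mul_add, add_mul, mul_sub, sub_mul, mul_neg, neg_mul, mul_smul_comm, smul_mul_assoc,
    mul_one, one_mul, mul_assoc, D.r_r, D.r_r']
  module

/-- `R̂ L₂ R̂`-commutation, moved to the other side of `L`. -/
theorem slide_l {x : M} (h : x * R * l * R = R * l * R * x) (y : M) :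
    r * (x * (R * (l * y))) = l * (R * (x * (r * y))) := by
  have h' := congrArg (fun z => r * z * (r * y)) h
  simpa only [mul_assoc, D.R_r', D.r_R'] using h'

/-- Sandwiching the hypothesis between copies of `r * li * r`, the inverse of `R * l * R`, transfers
it to `L⁻¹`. The tail `y` lets the rule rewrite inside right-associated words. -/
theorem slide_li {x : M} (h : x * R * l * R = R * l * R * x) (y : M) :
    r * (li * (r * (x * y))) = x * (r * (li * (r * y))) := by
  have h' := congrArg (fun z => r * li * r * z * (r * li * r * y)) h
  have e1 (z : M) : l * (li * z) = z := by rw [← mul_assoc, D.l_li, one_mul]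
  have e2 (z : M) : li * (l * z) = z := by rw [← mul_assoc, D.li_l, one_mul]
  simpa only [mul_assoc, D.R_r', D.r_R', e1, e2] using h'

theorem W_l : W * R * l * R = R * l * R * W := by
  have h1 : Commute w (R * l * R) := by
    rw [commute_iff_eq]
    simpa only [mul_assoc] using D.w_l
  have h2 : Commute j (R * l * R) := by
    rw [commute_iff_eq]
    simpa only [mul_assoc] using D.j_l
  have h : Commute W (R * l * R) := by
    rw [D.W_eq]
    exact (Commute.one_left _).add_left ((h1.mul_left h2).smul_left c)
  simpa only [mul_assoc] using h.eq

theorem Wb_l : Wb * R * l * R = R * l * R * Wb := by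
  have h1 : Commute w (R * l * R) := by
    rw [commute_iff_eq]
    simpa only [mul_assoc] using D.w_l
  have h2 : Commute j (R * l * R) := by
    rw [commute_iff_eq]
    simpa only [mul_assoc] using D.j_l
  have h : Commute Wb (R * l * R) := by
    rw [D.Wb_eq]
    exact (Commute.one_left _).add_left ((h2.mul_left h1).smul_left c)
  simpa only [mul_assoc] using h.eq

/-! ### Exchange relations of the current `U` -/

/-- R̂UR̂⁻¹ factors as (R̂WR̂)(R̂⁻¹L⁻¹R̂⁻¹)(R̂W̄R̂⁻¹), and `ω` passes each factor by a known rule.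
-/
theorem U_w : R * (W * li * Wb) * r * w = w * r * (W * li * Wb) * R :=
  calc R * (W * li * Wb) * r * w = R * W * R * (r * (li * (r * (R * Wb * r * w)))) := by
        simp only [mul_assoc, D.r_R', D.R_r']
    _ = R * W * R * w * (r * (li * (r * (R * Wb * R)))) := by
        rw [D.Wb_w]
        simp only [mul_assoc, D.slide_li D.w_l]
    _ = w * r * (W * li * Wb) * R := by
        rw [D.W_w]
        simp only [mul_assoc, D.r_R', D.R_r']

theorem U_j : r * (W * li * Wb) * R * j = j * R * (W * li * Wb) * r :=
  calc r * (W * li * Wb) * R * j = r * W * R * (r * (li * (r * (R * Wb * R * j)))) := by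
        simp only [mul_assoc, D.r_R', D.R_r']
    _ = r * W * R * j * (r * (li * (r * (R * Wb * r)))) := by
        rw [D.Wb_j]
        simp only [mul_assoc, D.slide_li D.j_l]
    _ = j * R * (W * li * Wb) * r := by
        rw [D.W_j]
        simp only [mul_assoc, D.r_R', D.R_r']

theorem l_inv_cancel (z : M) : l * (li * z) = z := by rw [← mul_assoc, D.l_li, one_mul]

theorem inv_l_cancel (z : M) : li * (l * z) = z := by rw [← mul_assoc, D.li_l, one_mul]

/-- `X₂ R̂⁻¹ L⁻¹₂ = R̂⁻¹ L⁻¹₂ R̂⁻¹ X₂ R̂` when `X` commutes with `R̂ L₂ R̂`. -/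
theorem slide_li' {x : M} (h : x * R * l * R = R * l * R * x) (y : M) :
    x * (r * (li * y)) = r * (li * (r * (x * (R * y)))) := by
  rw [D.slide_li h]
  simp only [D.r_R']

theorem li_li (y : M) : li * (r * (li * (r * y))) = r * (li * (r * (li * y))) := by
  have h := congrArg (fun z => li * z) (D.slide_li' D.l_l (r * (li * y)))
  simp only [D.R_r', D.l_inv_cancel, D.inv_l_cancel] at h
  exact h.symm

theorem U_li : R * (W * li * Wb) * r * li = li * r * (W * li * Wb) * R := by
  have h1 := D.slide_li' D.Wb_l 1
  rw [mul_one, mul_one] at h1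
  simp only [mul_assoc]
  rw [h1, D.li_li, D.slide_li' D.W_l, D.R_r', D.R_r']

theorem U_W : R * (W * li * Wb) * r * W = W * (R * (W * li * Wb) * r) := by
  have h1 := D.U_w
  have h2 := D.U_j
  generalize W * li * Wb = U at h1 h2 ⊢
  rw [D.W_eq]
  linear_combination (norm := skip) c • (h1 * j) + c • (w * h2)
  simp only [mul_add, add_mul, mul_smul_comm, smul_mul_assoc, mul_one, one_mul, mul_assoc]
  module

theorem U_Wb : r * (W * li * Wb) * R * Wb = Wb * (r * (W * li * Wb) * R) := by
  have h1 := D.U_w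
  have h2 := D.U_j
  generalize W * li * Wb = U at h1 h2 ⊢
  rw [D.Wb_eq]
  linear_combination (norm := skip) c • (h2 * w) + c • (j * h1)
  simp only [mul_add, add_mul, mul_smul_comm, smul_mul_assoc, mul_one, one_mul, mul_assoc]
  module

/-- R̂UR̂⁻¹ is carried through `W`, `L⁻¹` and `W̄` in turn, coming out as R̂⁻¹UR̂. Replacing R̂ by
R̂⁻¹ + λ then adds the same term λUR̂⁻¹U to both sides. -/
theorem U_U : r * (W * li * Wb) * r * (W * li * Wb) = (W * li * Wb) * r * (W * li * Wb) * r := by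
  have h : R * (W * li * Wb) * r * (W * li * Wb) = W * li * Wb * (r * (W * li * Wb) * R) :=
    calc R * (W * li * Wb) * r * (W * li * Wb)
        = R * (W * li * Wb) * r * W * li * Wb := by simp only [mul_assoc]
      _ = W * (R * (W * li * Wb) * r * li) * Wb := by rw [D.U_W]; simp only [mul_assoc]
      _ = W * li * (r * (W * li * Wb) * R * Wb) := by rw [D.U_li]; simp only [mul_assoc]
      _ = _ := by rw [D.U_Wb]; simp only [mul_assoc]
  generalize W * li * Wb = U at h ⊢
  rw [D.hecke] at h
  linear_combination (norm := skip) h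
  simp only [mul_add, add_mul, mul_smul_comm, smul_mul_assoc, mul_one, one_mul, mul_assoc]
  module

/-! ### Exchange relations of `Θ = ω L W⁻¹` -/

theorem Wi_W' (y : M) : Wi * (W * y) = y := by rw [← mul_assoc, D.Wi_W, one_mul]

theorem W_Wi' (y : M) : W * (Wi * y) = y := by rw [← mul_assoc, D.W_Wi, one_mul]

theorem Wi_j (y : M) : Wi * (R * (j * y)) = R * (j * (r * (Wi * (r * y)))) := by
  have h := congrArg (fun z => Wi * R * z * (r * Wi * r * y)) D.W_j
  simp only [mul_assoc, D.R_r', D.Wi_W', D.W_Wi'] at h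
  exact h.symm

theorem Wi_w (y : M) : Wi * (r * (w * y)) = R * (w * (r * (Wi * (R * y)))) := by
  have h := congrArg (fun z => R * (r * Wi * r * z * (r * Wi * R * y))) D.W_w
  simp only [mul_assoc, D.r_R', D.R_r', D.Wi_W', D.W_Wi'] at h
  exact h.symm

theorem Wi_l (y : M) : Wi * (R * (l * y)) = R * (l * (R * (Wi * (r * y)))) := by
  have h := congrArg (fun z => Wi * z * (Wi * (r * y))) D.W_l
  simp only [mul_assoc, D.R_r', D.Wi_W', D.W_Wi'] at h
  exact h.symm

theorem W_W : W * (R * W * R) = R * W * R * W := by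
  have h1 := D.W_w
  have h2 := D.W_j
  have h : Commute (1 + c • (w * j)) (R * W * R) := by
    refine (Commute.one_left _).add_left (Commute.smul_left ?_ c)
    rw [commute_iff_eq]
    calc w * j * (R * W * R) = w * (j * R * W * R) := by simp only [mul_assoc]
      _ = w * r * W * R * j := by rw [← h2]; simp only [mul_assoc]
      _ = R * W * R * (w * j) := by rw [← h1]; simp only [mul_assoc]
  rw [← D.W_eq] at h
  exact h.eq

theorem W_Wi_r : R * W * r * Wi * r = Wi * R * W - c • 1 := by
  have h := congrArg (fun z => Wi * z * Wi * r) D.W_W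
  simp only [mul_assoc, D.Wi_W', D.W_Wi', D.R_r, mul_one] at h
  have e : r = R - c • 1 := eq_sub_of_add_eq D.hecke.symm
  calc R * W * r * Wi * r = R * W * R * Wi * r - c • (R * (W * (Wi * r))) := by
        conv_lhs => rw [mul_assoc (R * W), mul_assoc (R * W)]; enter [2, 1]; rw [e]
        simp only [mul_sub, sub_mul, mul_smul_comm, smul_mul_assoc, one_mul, mul_assoc]
    _ = Wi * R * W - c • 1 := by
        rw [D.W_Wi', D.R_r]
        simp only [mul_assoc]
        rw [h]

/-- The right side is kept in this form because its partial trace is explicit: with Tr_q R̂ = q^{2N}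
and λ Tr_q 1 = q^{2N} − 1 the bracket becomes 1. -/
theorem theta_j : r * (w * l * Wi) * R * j + j * R * (w * l * Wi) * r
    = -(l * (Wi * R * W - c • 1)) := by
  have h1 := D.Wi_j 1
  rw [mul_one, mul_one] at h1
  have h2 := D.slide_l D.j_l
  have h3 : r * w * r * j = -(j * R * w * r) - r * W := by
    have h := D.w_j
    rw [D.W_eq]
    rw [D.hecke] at h ⊢
    linear_combination (norm := skip) r * h * r
    simp only [mul_add, add_mul, mul_neg, neg_mul, mul_smul_comm, smul_mul_assoc, mul_one,
      one_mul, mul_assoc, D.r_r, D.r_r', mul_sub, sub_mul, smul_sub, smul_add]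
    module
  rw [← D.W_Wi_r]
  have h4 := congrArg (fun z => z * (R * (l * (Wi * r)))) h3
  simp only [mul_assoc, sub_mul, neg_mul, D.r_R', D.slide_l D.W_l] at h4 ⊢
  rw [h1, ← h2, h4]
  abel

theorem theta_l : r * (w * l * Wi) * R * l = l * R * (w * l * Wi) * r := by
  have h1 := D.Wi_l 1
  rw [mul_one, mul_one] at h1
  have h2 := D.l_l
  have h3 := D.slide_l D.w_l
  have h4 (y : M) : l * (R * (l * (R * y))) = R * (l * (R * (l * y))) := by
    simpa only [mul_assoc] using congrArg (fun z => z * y) D.l_l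
  simp only [mul_assoc]
  rw [h1, h4, h3, D.r_R']

theorem theta_w : R * (w * l * Wi) * r * w = -(w * r * (w * l * Wi) * R) := by
  have h1 := D.Wi_w 1
  rw [mul_one, mul_one] at h1
  have h2 (y : M) : l * (R * (w * (r * y))) = r * (w * (R * (l * y))) := (D.slide_l D.w_l y).symm
  have h3 (y : M) : R * (w * (r * (w * (R * y)))) = -(w * (r * (w * y))) := by
    have h := congrArg (fun z => R * z * y) D.w_w
    simpa only [mul_assoc, mul_neg, neg_mul, D.R_r'] using h
  simp only [mul_assoc]
  rw [h1, h2, h3]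

theorem theta_W : r * (w * l * Wi) * r * W = W * (R * (w * l * Wi) * r) := by
  have h1 := D.theta_w
  have h2 := D.theta_j
  have h3 : w * l = w * l * Wi * W := by rw [mul_assoc _ Wi, D.Wi_W, mul_one]
  have h4 : w * (l * (Wi * R * W - c • 1)) = w * l * Wi * r * W := by
    have e : r = R - c • 1 := eq_sub_of_add_eq D.hecke.symm
    rw [e]
    simp only [mul_sub, sub_mul, mul_smul_comm, smul_mul_assoc, mul_one, ← mul_assoc]
    rw [← h3]
  -- The inhomogeneous term of `theta_j` leaves an extra summand; it is exactly what turns the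
  -- leading `R` into `r`.
  have h5 : R * (w * l * Wi) * r * W = W * (R * (w * l * Wi) * r) + c • (w * l * Wi * r * W) := by
    rw [← h4]
    generalize w * l * Wi = t at h1 h2 ⊢
    rw [D.W_eq] at h2 ⊢
    linear_combination (norm := skip) c • (h1 * j) - c • (w * h2)
    simp only [mul_add, add_mul, mul_smul_comm, smul_mul_assoc, mul_one, one_mul, mul_assoc,
      mul_neg, neg_mul]
    module
  rw [← sub_eq_iff_eq_add] at h5
  rw [← h5, D.hecke]
  simp only [add_mul, smul_mul_assoc, one_mul, mul_assoc]
  module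

theorem theta_theta : (w * l * Wi) * r * (w * l * Wi) * R
    = -(r * (w * l * Wi) * r * (w * l * Wi)) := by
  have h1 (y : M) : w * (l * (Wi * (R * (l * y)))) = R * (l * (R * (w * (l * (Wi * (r * y)))))) := by
    have h := congrArg (fun z => R * z * y) D.theta_l
    simpa only [mul_assoc, D.R_r'] using h
  have h2 (y : M) : w * (l * (Wi * (r * (Wi * y))))
      = r * (Wi * (r * (w * (l * (Wi * (r * y)))))) := by
    have h := congrArg (fun z => r * Wi * z * Wi * y) D.theta_W
    simpa only [mul_assoc, D.Wi_W', D.W_Wi', D.r_R'] using h.symm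
  have h3 (y : M) : w * (l * (Wi * (r * (w * y)))) = -(r * (w * (r * (w * (l * (Wi * (R * y))))))) := by
    have h := congrArg (fun z => r * z * y) D.theta_w
    simpa only [mul_assoc, mul_neg, neg_mul, D.r_R'] using h
  simp only [mul_assoc]
  rw [h3, h1, D.r_R', h2, D.R_r', D.r_R, mul_one]

/-! ### Exchange relations of `Θ* = J L⁻¹ W̄` -/

theorem thetaStar_w : R * (j * li * Wb) * r * w + w * R * (j * li * Wb) * R
    = -(li * Wb * R) := by
  have h1 : R * (j * li * Wb) * r * w = R * j * R * w * (r * (li * (Wb * R))) :=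
    calc R * (j * li * Wb) * r * w = R * j * R * (r * (li * (r * (R * Wb * r * w)))) := by
          simp only [mul_assoc, D.r_R', D.R_r']
      _ = _ := by
          rw [D.Wb_w]
          simp only [mul_assoc, D.slide_li D.w_l, D.r_R']
  have h2 := congrArg (fun z => z * (r * (li * (Wb * R)))) D.w_j
  simp only [add_mul] at h2
  rw [h1, add_comm]
  simpa only [mul_assoc, neg_mul, D.R_r'] using h2

theorem thetaStar_j : r * (j * li * Wb) * R * j = -(j * R * (j * li * Wb) * r) :=
  calc r * (j * li * Wb) * R * j = r * j * R * (r * (li * (r * (R * Wb * R * j)))) := by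
        simp only [mul_assoc, D.r_R', D.R_r']
    _ = r * j * R * j * (r * (li * (Wb * r))) := by
        rw [D.Wb_j]
        simp only [mul_assoc, D.slide_li D.j_l, D.r_R']
    _ = -(j * R * (j * li * Wb) * r) := by
        rw [← neg_eq_iff_eq_neg.mpr D.j_j]
        simp only [mul_assoc, neg_mul, D.R_r']

theorem thetaStar_li (y : M) : j * (li * (Wb * (r * (li * y))))
    = r * (li * (r * (j * (li * (Wb * (R * y)))))) := by
  rw [D.slide_li' D.Wb_l, D.li_li, D.slide_li' D.j_l, D.R_r']

/-- Passing through the product in `W̄` leaves an extra term λΘ*R̂, because J·L⁻¹W̄ = Θ*; it turns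
the leading R̂⁻¹ into R̂. -/
theorem thetaStar_Wb : r * (j * li * Wb) * R * Wb = Wb * (R * (j * li * Wb) * R) := by
  have h1 := D.thetaStar_j
  have h2 := D.thetaStar_w
  have h3 : j * (li * Wb * R) = j * li * Wb * R := by simp only [mul_assoc]
  have h4 := congrArg (fun z => j * z) h2
  simp only [mul_neg] at h4
  rw [h3] at h4
  generalize j * li * Wb = s at h1 h4 ⊢
  rw [D.Wb_eq]
  rw [D.hecke] at h1 h4 ⊢
  linear_combination (norm := skip) c • (h1 * w) - c • h4
  simp only [mul_add, add_mul, mul_smul_comm, smul_mul_assoc, mul_one, one_mul, mul_assoc,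
    neg_mul]
  module

theorem thetaStar_thetaStar : (j * li * Wb) * R * (j * li * Wb) * R
    = -(r * (j * li * Wb) * R * (j * li * Wb)) := by
  have h1 (y : M) : j * (li * (Wb * (R * (j * y))))
      = -(R * (j * (R * (j * (li * (Wb * (r * y))))))) := by
    have h := congrArg (fun z => R * z * y) D.thetaStar_j
    simpa only [mul_assoc, mul_neg, neg_mul, D.R_r'] using h
  have h2 : r * (j * (li * (Wb * (R * Wb)))) = Wb * (R * (j * (li * (Wb * R)))) := by
    simpa only [mul_assoc] using D.thetaStar_Wb
  have h3 := congrArg (fun z => r * z) (h1 (li * Wb))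
  rw [D.thetaStar_li, h2, D.R_r'] at h3
  simp only [mul_assoc, mul_neg, D.r_R'] at h3 ⊢
  rw [h3, neg_neg]

end HeckeDiff
end QuantumGL

/-! ### Entries of `R̂` and the Hecke condition -/

namespace QuantumGL

section Matrices

variable {k : Type*} [Field k] {A : Type*} [Ring A] [Algebra k A] {q : k} {N : ℕ}

theorem RHat_apply (q : k) (a b c d : Fin N) :
    RHat q N (a, b) (c, d) = (if b = c then if a = d then if a = b then q else 1 else 0 else 0)
      + (if a = c then if b = d then if a < b then lam q else 0 else 0 else 0) := by
  have h : RHat q N (a, b) (c, d) = RMat q N (b, a) (c, d) := by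
    simp [RHat, Matrix.mul_apply, PMat, Fintype.sum_prod_type, ite_and]
  rw [h]
  have h1 : 1 + (q - 1) * (if b = a then 1 else 0) = if a = b then q else 1 := by
    by_cases h : a = b
    · simp [h]
    · simp [h, Ne.symm h]
  simp only [RMat, Matrix.of_apply, lam, h1]
  simp only [and_comm (a := b = d)]
  simp only [ite_and, mul_ite, mul_one, mul_zero]

theorem RA_mul_apply (q : k) (X : Matrix (Fin N × Fin N) (Fin N × Fin N) A) (a b : Fin N)
    (y : Fin N × Fin N) : (RA A q N * X) (a, b) y
      = (if a = b then q else 1) • X (b, a) y + (if a < b then lam q else 0) • X (a, b) y := by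
  simp [Matrix.mul_apply, RA, RHat_apply, Fintype.sum_prod_type, add_mul, Finset.sum_add_distrib,
    apply_ite (algebraMap k A), ite_mul, Algebra.smul_def]

theorem mul_RA_apply (q : k) (X : Matrix (Fin N × Fin N) (Fin N × Fin N) A) (a b : Fin N)
    (x : Fin N × Fin N) : (X * RA A q N) x (a, b)
      = (if a = b then q else 1) • X x (b, a) + (if a < b then lam q else 0) • X x (a, b) := by
  have h (e : k) (z : A) : z * algebraMap k A e = e • z := by
    rw [Algebra.smul_def, Algebra.commutes]
  simp only [Matrix.mul_apply, RA, Matrix.map_apply, h, Fintype.sum_prod_type, RHat_apply, add_smul,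
    Finset.sum_add_distrib, ite_smul, zero_smul, Finset.sum_ite_eq',
    Finset.mem_univ, if_true]
  simp [eq_comm]

theorem RHat_mul (hq : q ≠ 0) : RHat q N * (RHat q N - lam q • 1) = 1 := by
  have h1 : RHat q N = RA k q N := by
    ext
    simp [RA]
  rw [h1, mul_sub, mul_smul_comm, mul_one]
  ext ⟨a, b⟩ y
  have h2 (a b : Fin N) : RA k q N (a, b) y = (if a = b then q else 1)
      * (1 : Matrix (Fin N × Fin N) (Fin N × Fin N) k) (b, a) y + (if a < b then lam q else 0)
      * (1 : Matrix (Fin N × Fin N) (Fin N × Fin N) k) (a, b) y := by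
    simpa using RA_mul_apply q (1 : Matrix (Fin N × Fin N) (Fin N × Fin N) k) a b y
  simp only [Matrix.sub_apply, Matrix.smul_apply, RA_mul_apply, h2, smul_eq_mul]
  generalize (1 : Matrix (Fin N × Fin N) (Fin N × Fin N) k) = I
  rcases lt_trichotomy a b with h | h | h
  · simp [h, h.ne, h.ne', h.not_gt]
  · subst h
    simp only [if_true, lt_irrefl, if_false, lam]
    field_simp
    ring
  · simp [h, h.ne, h.ne', h.not_gt]

theorem RHat_inv (hq : q ≠ 0) : (RHat q N)⁻¹ = RHat q N - lam q • 1 :=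
  Matrix.inv_eq_right_inv (RHat_mul hq)

variable (A N) in
theorem RA_eq (hq : q ≠ 0) : RA A q N = RAInv A q N + lam q • 1 := by
  ext a b
  simp only [RA, RAInv, RHat_inv hq, Matrix.map_apply, Matrix.sub_apply, Matrix.add_apply,
    Matrix.smul_apply, Matrix.one_apply, map_sub]
  split_ifs <;> simp [Algebra.smul_def]

variable (A N) in
theorem RA_mul_RAInv (hq : q ≠ 0) : RA A q N * RAInv A q N = 1 := by
  rw [RA, RAInv, ← Matrix.map_mul, RHat_inv hq, RHat_mul hq, Matrix.map_one _ (map_zero _) (map_one _)]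

variable (A N) in
theorem RAInv_mul_RA (hq : q ≠ 0) : RAInv A q N * RA A q N = 1 := by
  rw [RA, RAInv, ← Matrix.map_mul, RHat_inv hq, mul_eq_one_comm.mp (RHat_mul hq),
    Matrix.map_one _ (map_zero _) (map_one _)]

theorem sp2_apply (X : Matrix (Fin N) (Fin N) A) (a b c d : Fin N) :
    sp2 X (a, b) (c, d) = if a = c then X b d else 0 := by
  simp [sp2, Matrix.kroneckerMap_apply, Matrix.one_apply]

theorem mul_sp2_apply (M : Matrix (Fin N × Fin N) (Fin N × Fin N) A) (X : Matrix (Fin N) (Fin N) A)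
    (x : Fin N × Fin N) (c d : Fin N) : (M * sp2 X) x (c, d) = ∑ b, M x (c, b) * X b d := by
  simp [Matrix.mul_apply, Fintype.sum_prod_type_right, sp2_apply]

theorem sp2_mul_apply (M : Matrix (Fin N × Fin N) (Fin N × Fin N) A) (X : Matrix (Fin N) (Fin N) A)
    (x : Fin N × Fin N) (a b : Fin N) : (sp2 X * M) (a, b) x = ∑ c, X b c * M (a, c) x := by
  simp [Matrix.mul_apply, Fintype.sum_prod_type_right, sp2_apply]

theorem sp2_mul (X Y : Matrix (Fin N) (Fin N) A) : sp2 (X * Y) = sp2 X * sp2 Y := by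
  ext ⟨a, b⟩ ⟨c, d⟩
  rw [mul_sp2_apply]
  simp only [sp2_apply, Matrix.mul_apply]
  split_ifs <;> simp

theorem sp2_one : sp2 (1 : Matrix (Fin N) (Fin N) A) = 1 := by
  simp [sp2]

theorem sp2_one_add_smul (c : k) (X : Matrix (Fin N) (Fin N) A) :
    sp2 (1 + c • X) = 1 + c • sp2 X := by
  rw [← sp2_one]
  ext ⟨a, b⟩ ⟨c, d⟩
  simp only [sp2_apply, Matrix.add_apply, Matrix.smul_apply]
  split_ifs <;> simp

/-! ### The partial quantum trace -/

/-- The partial quantum trace `Tr_q` over the first tensor factor. -/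
def ptr (q : k) : Matrix (Fin N × Fin N) (Fin N × Fin N) A →ₗ[k] Matrix (Fin N) (Fin N) A where
  toFun M := Matrix.of fun i j => ∑ m, DInv q N m m • M (m, i) (m, j)
  map_add' M M' := by
    ext
    simp [Finset.sum_add_distrib]
  map_smul' c M := by
    ext
    simp [Finset.smul_sum, smul_comm c]

theorem ptr_apply (q : k) (M : Matrix (Fin N × Fin N) (Fin N × Fin N) A) (i j : Fin N) :
    ptr q M i j = ∑ m, DInv q N m m • M (m, i) (m, j) := rfl

theorem ptr_mul_sp2 (M : Matrix (Fin N × Fin N) (Fin N × Fin N) A) (X : Matrix (Fin N) (Fin N) A) :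
    ptr q (M * sp2 X) = ptr q M * X := by
  ext i j
  simp only [ptr_apply, mul_sp2_apply, Finset.smul_sum]
  rw [Matrix.mul_apply]
  simp only [ptr_apply, Finset.sum_mul]
  rw [Finset.sum_comm]
  simp

theorem ptr_sp2_mul (M : Matrix (Fin N × Fin N) (Fin N × Fin N) A) (X : Matrix (Fin N) (Fin N) A) :
    ptr q (sp2 X * M) = X * ptr q M := by
  ext i j
  simp only [ptr_apply, sp2_mul_apply, Finset.smul_sum]
  rw [Matrix.mul_apply]
  simp only [ptr_apply, Finset.mul_sum]
  rw [Finset.sum_comm]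
  simp

/-- The quantum trace as a linear map. -/
def qTrLin (q : k) (N : ℕ) (A : Type*) [Ring A] [Algebra k A] :
    Matrix (Fin N) (Fin N) A →ₗ[k] A where
  toFun := qTr q
  map_add' X Y := by simp [qTr, mul_add]
  map_smul' c X := by simp [qTr]

theorem qTr_eq_sum (X : Matrix (Fin N) (Fin N) A) : qTr q X = ∑ m, DInv q N m m • X m m := by
  have h : (DInv q N).map (algebraMap k A)
      = Matrix.diagonal fun m => algebraMap k A (DInv q N m m) := by
    ext i j
    by_cases h : i = j <;> simp [DInv, h]
  simp [qTr, h, Matrix.trace, Matrix.diagonal_mul, Algebra.smul_def]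

theorem q_mul_DInv (m : Fin N) : q * DInv q N m m = q ^ (2 * (N - m.val)) := by
  have : N - m.val = N - (m.val + 1) + 1 := by have := m.isLt; omega
  rw [DInv, Matrix.diagonal_apply_eq, this]
  ring

theorem sum_DInv (hq : q ≠ 0) (n : ℕ) (hn : n ≤ N) :
    lam q * ∑ m : Fin N, (if m.val < n then DInv q N m m else 0)
      = q ^ (2 * N) - q ^ (2 * (N - n)) := by
  induction n with
  | zero => simp
  | succ n ih =>
    have h (m : Fin N) : (if m.val < n + 1 then DInv q N m m else 0)
        = (if m.val < n then DInv q N m m else 0) + (if m = ⟨n, hn⟩ then DInv q N m m else 0) := by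
      simp only [Fin.ext_iff]
      rcases lt_trichotomy m.val n with h | h | h
      · simp [h, h.ne, h.trans (Nat.lt_succ_self n)]
      · simp [h]
      · simp [h.not_gt, h.ne', Nat.not_lt.mpr h]
    -- The bound `n + 1 ≤ N` makes the truncated subtraction exact, so the geometric sum telescopes.
    have e : N - n = N - (n + 1) + 1 := by omega
    simp only [h, Finset.sum_add_distrib, Finset.sum_ite_eq', Finset.mem_univ, if_true, mul_add]
    rw [ih (by omega), e, DInv, Matrix.diagonal_apply_eq, lam]
    field_simp
    ring

theorem sum_DInv_lt (hq : q ≠ 0) (i : Fin N) :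
    lam q * ∑ m : Fin N, (if m < i then DInv q N m m else 0)
      = q ^ (2 * N) - q * DInv q N i i := by
  rw [q_mul_DInv, ← sum_DInv hq i.val i.isLt.le]
  rfl

theorem lam_mul_sum_DInv (hq : q ≠ 0) : lam q * ∑ m : Fin N, DInv q N m m = q ^ (2 * N) - 1 := by
  have h := sum_DInv (N := N) hq N le_rfl
  simpa using h

theorem ptr_one (q : k) : ptr q (1 : Matrix (Fin N × Fin N) (Fin N × Fin N) A)
    = (∑ m : Fin N, DInv q N m m) • 1 := by
  ext i j
  simp [ptr_apply, Matrix.one_apply, Prod.mk.injEq, Finset.sum_smul]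

theorem ptr_RA (hq : q ≠ 0) : ptr q (RA A q N) = q ^ (2 * N) • 1 := by
  ext i j
  have h (m : Fin N) : RA A q N (m, i) (m, j) = if i = j then (if m = i then algebraMap k A q else 0)
      + (if m < i then algebraMap k A (lam q) else 0) else 0 := by
    rw [RA, Matrix.map_apply, RHat_apply]
    split_ifs <;> simp_all
  simp only [ptr_apply, h, Matrix.smul_apply, Matrix.one_apply]
  split_ifs with hij
  · have h2 : q ^ (2 * N) = DInv q N i i * q + ∑ m, (if m < i then DInv q N m m else 0) * lam q := by
      rw [← Finset.sum_mul, mul_comm _ (lam q), sum_DInv_lt hq]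
      ring
    rw [h2]
    simp only [smul_add, Finset.sum_add_distrib, add_smul, Finset.sum_smul, smul_ite, smul_zero,
      Finset.sum_ite_eq', Finset.mem_univ, if_true]
    simp [Algebra.smul_def, apply_ite (algebraMap k A)]
  · simp

theorem ptr_RAInv (hq : q ≠ 0) : ptr q (RAInv A q N) = 1 := by
  have h := congrArg (ptr q) (RA_eq A N hq)
  rw [map_add, map_smul, ptr_one, ptr_RA hq, smul_smul, lam_mul_sum_DInv hq, sub_smul, one_smul] at h
  have := eq_sub_of_add_eq h.symm
  rw [this]
  abel

/-- The weights in `D⁻¹` are such that λ times the sum of those with index below `i` is q^{2N} minus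
q times the weight at `i`. This cancels every entry of `X` except those in the trace. -/
theorem ptr_conj (hq : q ≠ 0) (X : Matrix (Fin N) (Fin N) A) :
    ptr q (RA A q N * sp2 X * RAInv A q N) = Matrix.diagonal fun _ => qTr q X := by
  have e : RAInv A q N = RA A q N - lam q • 1 := eq_sub_of_add_eq (RA_eq A N hq).symm
  ext i j
  -- A closed form for the diagonal blocks, checked over all relative orders of `m`, `i`, `j`. The
  -- last three terms are the ones that must cancel after weighting.
  have h (m : Fin N) : (RA A q N * sp2 X * RAInv A q N) (m, i) (m, j)
      = (if i = j then X m m else 0)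
        + (if m = i then ((if i = j then q ^ 2 - 1 else 0) - if j ≤ i then q * lam q else 0) • X i j
          else 0)
        + (if m = j then (if j < i then q * lam q else 0) • X i j else 0)
        - (lam q ^ 2 * ((if m < i then 1 else 0) - (if j ≤ i then if m < j then 1 else 0
          else if m < i then 1 else 0))) • X i j := by
    rw [mul_assoc, RA_mul_apply, e, mul_sub, mul_smul_comm, mul_one]
    simp only [Matrix.sub_apply, Matrix.smul_apply, mul_RA_apply, sp2_apply]
    rcases lt_trichotomy m i with h1 | h1 | h1 <;> rcases lt_trichotomy m j with h2 | h2 | h2 <;>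
      rcases lt_trichotomy i j with h3 | h3 | h3 <;> first
      | (exfalso; order)
      | (subst_vars
         simp [*, LT.lt.ne, LT.lt.ne', LT.lt.not_gt, LT.lt.le, LT.lt.not_ge, smul_smul]
         try module)
  have hD : ∑ m, DInv q N m m * (lam q ^ 2 * ((if m < i then 1 else 0)
      - (if j ≤ i then if m < j then 1 else 0 else if m < i then 1 else 0)))
      = if j ≤ i then lam q * (q * DInv q N j j - q * DInv q N i i) else 0 := by
    split_ifs with hji
    · have h1 := sum_DInv_lt hq i
      have h2 := sum_DInv_lt hq j
      have h3 : lam q * (q * DInv q N j j - q * DInv q N i i)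
          = lam q * (lam q * ∑ m, (if m < i then DInv q N m m else 0)
            - lam q * ∑ m, (if m < j then DInv q N m m else 0)) := by
        rw [h1, h2]
        ring
      rw [h3, ← mul_sub, ← Finset.sum_sub_distrib, Finset.mul_sum, Finset.mul_sum]
      refine Finset.sum_congr rfl fun m _ => ?_
      split_ifs <;> ring
    · simp
  have hD' : ∑ m, DInv q N m m • (lam q ^ 2 * ((if m < i then 1 else 0)
      - (if j ≤ i then if m < j then 1 else 0 else if m < i then 1 else 0))) • X i j
      = (if j ≤ i then lam q * (q * DInv q N j j - q * DInv q N i i) else 0) • X i j := by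
    rw [← hD, Finset.sum_smul]
    simp only [smul_smul]
  rw [ptr_apply]
  simp only [h, smul_add, smul_sub (DInv q N _ _), Finset.sum_add_distrib, Finset.sum_sub_distrib]
  rw [hD']
  simp only [smul_ite, smul_zero, Finset.sum_ite_eq', Finset.mem_univ, if_true]
  have hl : lam q = q - q⁻¹ := rfl
  rcases lt_trichotomy i j with h3 | h3 | h3
  · simp [h3.ne, h3.not_gt, h3.not_ge]
  · subst h3
    have hz : q ^ 2 - 1 - q * lam q = 0 := by
      rw [hl]
      field_simp
      ring
    simp [hz, qTr_eq_sum]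
  · simp only [h3, h3.ne', h3.le, if_true, if_false, Matrix.diagonal_apply_ne _ h3.ne',
      Finset.sum_const_zero]
    module

/-- The two conjugates differ by λ(X₂R̂⁻¹ − R̂⁻¹X₂), which has zero partial trace since R̂⁻¹ has
partial trace 1. -/
theorem ptr_conj_inv (hq : q ≠ 0) (X : Matrix (Fin N) (Fin N) A) :
    ptr q (RAInv A q N * sp2 X * RA A q N) = Matrix.diagonal fun _ => qTr q X := by
  have h1 := ptr_sp2_mul (q := q) (RAInv A q N) X
  have h2 := ptr_mul_sp2 (q := q) (RAInv A q N) X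
  rw [ptr_RAInv hq] at h1 h2
  rw [← ptr_conj hq, RA_eq A N hq]
  simp only [add_mul, mul_add, smul_mul_assoc, mul_smul_comm, one_mul, mul_one, map_add, map_smul,
    h1, h2]

theorem ptr_RA_RA (hq : q ≠ 0) (X : Matrix (Fin N) (Fin N) A) :
    ptr q (RA A q N * sp2 X * RA A q N)
      = (Matrix.diagonal fun _ => qTr q X) + (lam q * q ^ (2 * N)) • X := by
  rw [← ptr_conj hq]
  conv_lhs => enter [2, 2]; rw [RA_eq A N hq]
  rw [mul_add, mul_smul_comm, mul_one, map_add, map_smul, ptr_mul_sp2, ptr_RA hq, smul_mul_assoc,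
    one_mul, smul_smul]

theorem ptr_RAInv_RAInv (hq : q ≠ 0) (X : Matrix (Fin N) (Fin N) A) :
    ptr q (RAInv A q N * sp2 X * RAInv A q N)
      = (Matrix.diagonal fun _ => qTr q X) - lam q • X := by
  rw [← ptr_conj_inv hq]
  conv_rhs => enter [1, 2, 2]; rw [RA_eq A N hq]
  rw [mul_add, mul_smul_comm, mul_one, map_add, map_smul, ptr_mul_sp2, ptr_RAInv hq,
    one_mul, add_sub_cancel_right]

theorem qTr_diagonal_mul (a : A) (X : Matrix (Fin N) (Fin N) A) :
    qTr q ((Matrix.diagonal fun _ => a) * X) = a * qTr q X := by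
  simp [qTr_eq_sum, Finset.mul_sum]

theorem qTr_mul_diagonal (a : A) (X : Matrix (Fin N) (Fin N) A) :
    qTr q (X * Matrix.diagonal fun _ => a) = qTr q X * a := by
  simp [qTr_eq_sum, Finset.sum_mul]

/-- The quantum trace over both tensor factors is cyclic with respect to `R̂`. -/
theorem qTr_ptr_RA_comm (X : Matrix (Fin N × Fin N) (Fin N × Fin N) A) :
    qTr q (ptr q (RA A q N * X)) = qTr q (ptr q (X * RA A q N)) := by
  simp only [qTr_eq_sum, ptr_apply, RA_mul_apply, mul_RA_apply, smul_add, Finset.sum_add_distrib,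
    Finset.smul_sum]
  congr 1
  rw [Finset.sum_comm]
  refine Finset.sum_congr rfl fun a _ => Finset.sum_congr rfl fun b _ => ?_
  -- R̂ only permutes index pairs up to scalars, and the product of the two weights is symmetric.
  by_cases h : a = b
  · simp [h]
  · simp [h, Ne.symm h, smul_smul, mul_comm]

theorem qTr_ptr_RAInv_comm (hq : q ≠ 0) (X : Matrix (Fin N × Fin N) (Fin N × Fin N) A) :
    qTr q (ptr q (RAInv A q N * X)) = qTr q (ptr q (X * RAInv A q N)) := by
  have h := qTr_ptr_RA_comm (q := q) X
  change qTrLin q N A _ = qTrLin q N A _ at h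
  change qTrLin q N A _ = qTrLin q N A _
  rw [RA_eq A N hq] at h
  simpa [add_mul, mul_add] using h

/-! ### Quantum traces that square to zero -/

/-- This number is (q + q⁻¹)², the obstruction in the linear systems solved below. -/
theorem four_add_lam_sq_ne_zero (hq : q ≠ 0) (hq2 : q ^ 2 ≠ -1) : 4 + lam q ^ 2 ≠ 0 := by
  have h : 4 + lam q ^ 2 = ((q ^ 2 + 1) / q) ^ 2 := by
    rw [lam]
    field_simp
    ring
  rw [h]
  exact pow_ne_zero 2 (div_ne_zero (fun h => hq2 (eq_neg_of_add_eq_zero_left h)) hq)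

theorem RAInv_mul_RAInv (hq : q ≠ 0) : RAInv A q N * RAInv A q N = 1 - lam q • RAInv A q N := by
  have h := RAInv_mul_RA A N hq
  rw [RA_eq A N hq, mul_add, mul_smul_comm, mul_one] at h
  exact eq_sub_of_add_eq h

theorem ptr_sp2_mul₃ (X : Matrix (Fin N) (Fin N) A)
    (Y Z T : Matrix (Fin N × Fin N) (Fin N × Fin N) A) :
    ptr q (sp2 X * Y * Z * T) = X * ptr q (Y * Z * T) := by
  rw [← ptr_sp2_mul]
  simp only [mul_assoc]

theorem qTr_add (X Y : Matrix (Fin N) (Fin N) A) : qTr q (X + Y) = qTr q X + qTr q Y :=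
  (qTrLin q N A).map_add X Y

theorem qTr_zero : qTr q (0 : Matrix (Fin N) (Fin N) A) = 0 :=
  (qTrLin q N A).map_zero

theorem qTr_sub (X Y : Matrix (Fin N) (Fin N) A) : qTr q (X - Y) = qTr q X - qTr q Y :=
  (qTrLin q N A).map_sub X Y

theorem qTr_neg (X : Matrix (Fin N) (Fin N) A) : qTr q (-X) = -qTr q X :=
  (qTrLin q N A).map_neg X

theorem qTr_smul (c : k) (X : Matrix (Fin N) (Fin N) A) : qTr q (c • X) = c • qTr q X :=
  (qTrLin q N A).map_smul c X

/-- The quantum trace of a matrix with the exchange relation of `ω` squares to zero. -/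
theorem qTr_mul_self_of_omega (hq : q ≠ 0) (hq2 : q ^ 2 ≠ -1) {X : Matrix (Fin N) (Fin N) A}
    (h : sp2 X * RAInv A q N * sp2 X * RA A q N
      = -(RAInv A q N * sp2 X * RAInv A q N * sp2 X)) : qTr q X * qTr q X = 0 := by
  -- With a = (Tr_q X)² and b = Tr_q(X²), the double trace of the relation gives 2a = λb; after
  -- multiplication by R̂⁻¹ and cyclicity it gives (2 + λ²)b = λa. Eliminating b leaves (4 + λ²)a =
  -- 0.
  have h1 := congrArg (fun Y => qTr q (ptr q Y)) h
  have h2 := congrArg (fun Y => qTr q (ptr q (Y * RAInv A q N))) h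
  simp only [map_neg, ptr_sp2_mul₃, ptr_mul_sp2, ptr_conj_inv hq, ptr_RAInv_RAInv hq, qTr_neg,
    sub_mul, qTr_sub, qTr_diagonal_mul, qTr_mul_diagonal, smul_mul_assoc, qTr_smul] at h1
  have e : -(RAInv A q N * sp2 X * RAInv A q N * sp2 X) * RAInv A q N
      = -(RAInv A q N * (sp2 X * RAInv A q N * sp2 X * RAInv A q N)) := by
    simp only [neg_mul, mul_assoc]
  rw [mul_assoc _ (RA A q N), RA_mul_RAInv A N hq, mul_one, e, map_neg, qTr_neg,
    qTr_ptr_RAInv_comm hq, mul_assoc _ (RAInv A q N) (RAInv A q N), RAInv_mul_RAInv hq] at h2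
  simp only [mul_sub, mul_one, mul_smul_comm, map_sub, map_smul, ptr_sp2_mul₃, ptr_mul_sp2,
    ptr_sp2_mul, ptr_RAInv hq, ptr_RAInv_RAInv hq, qTr_sub, qTr_smul, qTr_mul_diagonal] at h2
  refine (smul_eq_zero.mp ?_).resolve_left (four_add_lam_sq_ne_zero hq hq2)
  generalize qTr q X * qTr q X = a at h1 h2 ⊢
  generalize qTr q (X * X) = b at h1 h2
  linear_combination (norm := module) (2 + lam q ^ 2) • h1 + lam q • h2

/-- The quantum trace of a matrix with the exchange relation of `J` squares to zero. -/
theorem qTr_mul_self_of_J (hq : q ≠ 0) (hq2 : q ^ 2 ≠ -1) {X : Matrix (Fin N) (Fin N) A}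
    (h : sp2 X * RA A q N * sp2 X * RA A q N
      = -(RAInv A q N * sp2 X * RA A q N * sp2 X)) : qTr q X * qTr q X = 0 := by
  -- The system is now 2a = −λq^{2N}b and 2q^{2N}b = λa, again giving (4 + λ²)a = 0.
  have h1 := congrArg (fun Y => qTr q (ptr q Y)) h
  have h2 := congrArg (fun Y => qTr q (ptr q (Y * RAInv A q N))) h
  simp only [map_neg, ptr_sp2_mul₃, ptr_mul_sp2, ptr_conj_inv hq, ptr_RA_RA hq, qTr_neg,
    mul_add, qTr_add, qTr_diagonal_mul, qTr_mul_diagonal, mul_smul_comm, qTr_smul] at h1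
  have e : -(RAInv A q N * sp2 X * RA A q N * sp2 X) * RAInv A q N
      = -(RAInv A q N * (sp2 X * RA A q N * sp2 X * RAInv A q N)) := by
    simp only [neg_mul, mul_assoc]
  rw [mul_assoc _ (RA A q N) (RAInv A q N), RA_mul_RAInv A N hq, mul_one, e, map_neg, qTr_neg,
    qTr_ptr_RAInv_comm hq, mul_assoc _ (RAInv A q N) (RAInv A q N), RAInv_mul_RAInv hq] at h2
  simp only [mul_sub, mul_one, mul_smul_comm, map_sub, map_smul, ptr_sp2_mul₃, ptr_mul_sp2,
    ptr_sp2_mul, ptr_RA hq, ptr_conj hq, qTr_sub, qTr_smul, qTr_mul_diagonal, smul_mul_assoc] at h2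
  refine (smul_eq_zero.mp ?_).resolve_left (four_add_lam_sq_ne_zero hq hq2)
  generalize qTr q X * qTr q X = a at h1 h2 ⊢
  generalize qTr q (X * X) = b at h1 h2
  linear_combination (norm := module) (2 : k) • h1 - lam q • h2

end Matrices
end QuantumGL

/-! ### Brackets of quantum traces with the generators -/

namespace QuantumGL

section Traces

variable {k : Type*} [Field k] {A : Type*} [Ring A] [Algebra k A] {q : k} {N : ℕ}
  {w j l li Wi : Matrix (Fin N) (Fin N) A}

/-- The scalar matrix with the quantum trace of `X` on the diagonal. -/
abbrev trD (q : k) (X : Matrix (Fin N) (Fin N) A) : Matrix (Fin N) (Fin N) A :=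
  Matrix.diagonal fun _ => qTr q X

theorem qTr_antiBrst_eq (hl : lam q ≠ 0) :
    qTr q ((lam q)⁻¹ • (j * (li - 1)) + j * li * j * w)
      = (lam q)⁻¹ • (qTr q (j * li * (1 + lam q • (j * w))) - qTr q j) := by
  rw [← qTr_sub, ← qTr_smul]
  congr 1
  simp only [mul_add, smul_add, mul_sub, smul_sub, mul_smul_comm, smul_smul, mul_one,
    inv_mul_cancel₀ hl, one_smul, mul_assoc]
  abel

/-- The relations between the matrices `ω`, `J`, `L`, `L⁻¹` and `W⁻¹` in a `k`-algebra. -/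
structure DiffRel (q : k) (w j l li Wi : Matrix (Fin N) (Fin N) A) : Prop where
  hecke : HeckeDiff (lam q) (RA A q N) (RAInv A q N) (sp2 w) (sp2 j) (sp2 l) (sp2 li)
    (sp2 (1 + lam q • (w * j))) (sp2 (1 + lam q • (j * w))) (sp2 Wi)
  l_li : l * li = 1
  li_l : li * l = 1
  W_Wi : (1 + lam q • (w * j)) * Wi = 1
  Wi_W : Wi * (1 + lam q • (w * j)) = 1
  q_ne : q ≠ 0

namespace DiffRel

variable (D : DiffRel q w j l li Wi)

include D

theorem trw_j : trD q w * j + j * trD q w = -1 := by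
  -- Multiplying by R̂⁻¹ on both sides leaves one conjugate of ω₂ next to J₂ in each term, as the
  -- partial trace requires.
  have h := congrArg (fun Y => ptr q (RAInv A q N * Y * RAInv A q N)) D.hecke.w_j
  have e1 : RAInv A q N * (sp2 w * RA A q N * sp2 j * RA A q N
      + RA A q N * sp2 j * RA A q N * sp2 w) * RAInv A q N
      = RAInv A q N * sp2 w * RA A q N * sp2 j + sp2 j * RA A q N * sp2 w * RAInv A q N := by
    simp only [mul_add, add_mul, mul_assoc, D.hecke.R_r, D.hecke.r_R', mul_one]
  have e2 : RAInv A q N * -RA A q N * RAInv A q N = -RAInv A q N := by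
    rw [mul_neg, D.hecke.r_R, neg_mul, one_mul]
  rwa [e1, e2, map_add, map_neg, ptr_mul_sp2, ptr_sp2_mul₃, ptr_conj_inv D.q_ne, ptr_conj D.q_ne,
    ptr_RAInv D.q_ne] at h

theorem trw_l : trD q w * l = l * trD q w := by
  have h := congrArg (ptr q) (D.hecke.slide_l D.hecke.w_l 1)
  simp only [mul_one, ← mul_assoc] at h
  rwa [ptr_mul_sp2, ptr_sp2_mul₃, ptr_conj_inv D.q_ne, ptr_conj D.q_ne] at h

theorem trw_w : trD q w * w + w * trD q w = lam q • (w * w) := by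
  have h := congrArg (ptr q) D.hecke.w_w
  rw [map_neg, ptr_mul_sp2, ptr_sp2_mul₃, ptr_conj_inv D.q_ne, ptr_RAInv_RAInv D.q_ne, sub_mul,
    smul_mul_assoc] at h
  rw [h]
  abel

theorem trtheta_j : trD q (w * l * Wi) * j + j * trD q (w * l * Wi) = -l := by
  have h := D.hecke.theta_j
  simp only [← sp2_mul] at h
  have h := congrArg (ptr q) h
  have e : sp2 Wi * RA A q N * sp2 (1 + lam q • (w * j))
      = sp2 Wi * (RA A q N * sp2 (1 + lam q • (w * j))) := mul_assoc _ _ _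
  rw [map_add, map_neg, ptr_mul_sp2, ptr_sp2_mul₃, ptr_conj_inv D.q_ne, ptr_conj D.q_ne,
    ptr_sp2_mul, map_sub, map_smul, e, ptr_sp2_mul, ptr_mul_sp2, ptr_RA D.q_ne, ptr_one,
    smul_mul_assoc, one_mul, mul_smul_comm, D.Wi_W, smul_smul, lam_mul_sum_DInv D.q_ne,
    ← sub_smul, sub_sub_cancel, one_smul, mul_one] at h
  exact h

theorem trtheta_l : trD q (w * l * Wi) * l = l * trD q (w * l * Wi) := by
  have h := D.hecke.theta_l
  simp only [← sp2_mul] at h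
  have h := congrArg (ptr q) h
  rwa [ptr_mul_sp2, ptr_sp2_mul₃, ptr_conj_inv D.q_ne, ptr_conj D.q_ne] at h

theorem trtheta_w : trD q (w * l * Wi) * w + w * trD q (w * l * Wi) = 0 := by
  have h := D.hecke.theta_w
  simp only [← sp2_mul] at h
  have h := congrArg (ptr q) h
  rw [map_neg, ptr_mul_sp2, ptr_sp2_mul₃, ptr_conj_inv D.q_ne, ptr_conj D.q_ne] at h
  exact add_eq_zero_iff_eq_neg.mpr h

/-- The partial trace of R̂Θ*₂R̂ exceeds Tr_q Θ* by λq^{2N}Θ*. The resulting λωΘ* joins L⁻¹W̄ to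
form WL⁻¹W̄ = U. -/
theorem trs_w : trD q (j * li * (1 + lam q • (j * w))) * w
    + w * trD q (j * li * (1 + lam q • (j * w)))
    = -(q ^ (2 * N) • ((1 + lam q • (w * j)) * li * (1 + lam q • (j * w)))) := by
  have h := D.hecke.thetaStar_w
  simp only [← sp2_mul] at h
  have h := congrArg (ptr q) h
  rw [map_add, map_neg, ptr_mul_sp2, ptr_sp2_mul₃, ptr_sp2_mul, ptr_conj D.q_ne,
    ptr_RA_RA D.q_ne, ptr_RA D.q_ne] at h
  generalize 1 + lam q • (j * w) = Wb at h ⊢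
  simp only [mul_add, add_mul, mul_smul_comm, smul_mul_assoc, mul_one, one_mul, mul_assoc] at h ⊢
  linear_combination (norm := module) h

theorem trs_j : trD q (j * li * (1 + lam q • (j * w))) * j
    + j * trD q (j * li * (1 + lam q • (j * w))) = 0 := by
  have h := D.hecke.thetaStar_j
  simp only [← sp2_mul] at h
  have h := congrArg (ptr q) h
  rw [map_neg, ptr_mul_sp2, ptr_sp2_mul₃, ptr_conj_inv D.q_ne, ptr_conj D.q_ne] at h
  exact add_eq_zero_iff_eq_neg.mpr h

theorem comm_li {T : Matrix (Fin N) (Fin N) A} (h : T * l = l * T) : T * li = li * T := by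
  have h' := congrArg (fun z => li * z * li) h
  simp only [mul_assoc, D.l_li, mul_one] at h'
  rw [h', ← mul_assoc li l, D.li_l, one_mul]

/-- Bracketing with Tr_q ω acts as an odd derivation on the factors of Θ*; the same computation with
Tr_q Θ gives `trtheta_s`. -/
theorem trw_s : trD q w * (j * li * (1 + lam q • (j * w)))
    + j * li * (1 + lam q • (j * w)) * trD q w
    = -(li * (1 + lam q • (j * w)) - lam q • (j * li * (1 + lam q • (j * w)) * w)) := by
  have h1 := D.trw_j
  have h2 := D.comm_li D.trw_l
  have h3 := D.trw_w
  generalize trD q w = T at h1 h2 h3 ⊢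
  linear_combination (norm := skip) h1 * (li * (1 + lam q • (j * w)))
    - j * h2 * (1 + lam q • (j * w)) - lam q • (j * li * h1 * w)
    + lam q • (j * li * j * h3)
  simp only [mul_add, add_mul, mul_neg, neg_mul, mul_smul_comm, smul_mul_assoc, mul_one, one_mul,
    mul_assoc]
  module

theorem trtheta_s : trD q (w * l * Wi) * (j * li * (1 + lam q • (j * w)))
    + j * li * (1 + lam q • (j * w)) * trD q (w * l * Wi) = -1 := by
  have h1 := D.trtheta_j
  have h2 := D.comm_li D.trtheta_l
  have h3 := D.trtheta_w
  have e (z : Matrix (Fin N) (Fin N) A) : l * (li * z) = z := by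
    rw [← mul_assoc, D.l_li, one_mul]
  have e' (z : Matrix (Fin N) (Fin N) A) : li * (l * z) = z := by
    rw [← mul_assoc, D.li_l, one_mul]
  generalize trD q (w * l * Wi) = T at h1 h2 h3 ⊢
  linear_combination (norm := skip) h1 * (li * (1 + lam q • (j * w)))
    - j * h2 * (1 + lam q • (j * w)) - lam q • (j * li * h1 * w)
    + lam q • (j * li * j * h3)
  simp only [mul_add, add_mul, mul_neg, neg_mul, mul_smul_comm, smul_mul_assoc, mul_one,
    mul_assoc, e, e', D.l_li, mul_zero]
  module

theorem brst_eq (hl : lam q ≠ 0) :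
    qTr q ((lam q)⁻¹ • (w * (l - 1)) - w * l * (w * j) * Wi)
      = (lam q)⁻¹ • (qTr q (w * l * Wi) - qTr q w) := by
  have h := congrArg (fun z => (lam q)⁻¹ • (w * l * z)) D.W_Wi
  simp only [add_mul, mul_add, smul_add, smul_mul_assoc, mul_smul_comm, smul_smul, one_mul,
    mul_one, inv_mul_cancel₀ hl, one_smul] at h
  rw [← qTr_sub, ← qTr_smul]
  congr 1
  rw [mul_sub, mul_one, smul_sub, ← h]
  simp only [mul_assoc, smul_sub]
  abel

theorem theta_sub_sq (hq2 : q ^ 2 ≠ -1) :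
    (qTr q (w * l * Wi) - qTr q w) * (qTr q (w * l * Wi) - qTr q w) = 0 := by
  have h1 := qTr_mul_self_of_omega D.q_ne hq2 D.hecke.w_w
  have h2 := D.hecke.theta_theta
  simp only [← sp2_mul] at h2
  have h3 := qTr_mul_self_of_omega D.q_ne hq2 h2
  have h4 := congrArg (qTr q) D.trtheta_w
  rw [qTr_add, qTr_diagonal_mul, qTr_mul_diagonal, qTr_zero] at h4
  linear_combination (norm := noncomm_ring) h1 + h3 - h4

theorem thetaStar_sub_sq (hq2 : q ^ 2 ≠ -1) :
    (qTr q (j * li * (1 + lam q • (j * w))) - qTr q j)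
      * (qTr q (j * li * (1 + lam q • (j * w))) - qTr q j) = 0 := by
  have h1 := qTr_mul_self_of_J D.q_ne hq2 D.hecke.j_j
  have h2 := D.hecke.thetaStar_thetaStar
  simp only [← sp2_mul] at h2
  have h3 := qTr_mul_self_of_J D.q_ne hq2 h2
  have h4 := congrArg (qTr q) D.trs_j
  rw [qTr_add, qTr_diagonal_mul, qTr_mul_diagonal, qTr_zero] at h4
  linear_combination (norm := noncomm_ring) h1 + h3 - h4

/-- The quantum Laplacian, up to the factor `λ⁻²`, in terms of an anticommutator. -/
theorem laplacian_eq_trace :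
    (qTr q (w * l * Wi) - qTr q w) * (qTr q (j * li * (1 + lam q • (j * w))) - qTr q j)
      + (qTr q (j * li * (1 + lam q • (j * w))) - qTr q j) * (qTr q (w * l * Wi) - qTr q w)
      = qTr q (l - 2) - (qTr q w * qTr q (j * li * (1 + lam q • (j * w)))
        + qTr q (j * li * (1 + lam q • (j * w))) * qTr q w) := by
  have h1 := congrArg (qTr q) D.trw_j
  have h2 := congrArg (qTr q) D.trtheta_j
  have h3 := congrArg (qTr q) D.trtheta_s
  simp only [qTr_add, qTr_diagonal_mul, qTr_mul_diagonal, qTr_neg] at h1 h2 h3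
  rw [← one_add_one_eq_two, qTr_sub, qTr_add]
  linear_combination (norm := noncomm_ring) h1 - h2 + h3

end DiffRel

end Traces

/-! ### Passage to the presented algebra -/

theorem mapMatrix_sp2 {k A B : Type*} [Field k] [Ring A] [Ring B] [Algebra k A] [Algebra k B]
    {N : ℕ} (f : A →ₐ[k] B) (X : Matrix (Fin N) (Fin N) A) :
    f.mapMatrix (sp2 X) = sp2 (X.map f) := by
  ext ⟨a, b⟩ ⟨c, d⟩
  simp only [AlgHom.mapMatrix_apply, Matrix.map_apply, sp2_apply]
  split_ifs <;> simp

theorem mapMatrix_RA {k A B : Type*} [Field k] [Ring A] [Ring B] [Algebra k A] [Algebra k B]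
    (q : k) (N : ℕ) (f : A →ₐ[k] B) : f.mapMatrix (RA A q N) = RA B q N := by
  ext a b
  simp [RA]

theorem mapMatrix_RAInv {k A B : Type*} [Field k] [Ring A] [Ring B] [Algebra k A] [Algebra k B]
    (q : k) (N : ℕ) (f : A →ₐ[k] B) : f.mapMatrix (RAInv A q N) = RAInv B q N := by
  ext a b
  simp [RAInv]

theorem mapMatrix_toDiff_eq {k n : Type*} [Field k] [Fintype n] [DecidableEq n] {q : k} {N : ℕ}
    {X Y : Matrix n n (FreeAlgebra k (Gen N))} (h : ∀ a b, Rel q N (X a b) (Y a b)) :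
    (toDiff q N).mapMatrix X = (toDiff q N).mapMatrix Y := by
  ext a b
  exact RingQuot.mkAlgHom_rel k (h a b)

theorem diffRel {k : Type*} [Field k] {q : k} (N : ℕ) (hq : q ≠ 0) :
    DiffRel q (omegaM q N) (JM q N) (LM q N) (LInvM q N) (WInvM q N) := by
  have l_li : LM q N * LInvM q N = 1 := by
    simpa [LM, LInvM] using mapMatrix_toDiff_eq (Rel.L_Linv (q := q) (N := N))
  have li_l : LInvM q N * LM q N = 1 := by
    simpa [LM, LInvM] using mapMatrix_toDiff_eq (Rel.Linv_L (q := q) (N := N))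
  have W_Wi : (1 + lam q • (omegaM q N * JM q N)) * WInvM q N = 1 := by
    have h := mapMatrix_toDiff_eq (Rel.W_Winv (q := q) (N := N))
    simp only [map_mul, map_add, map_smul, map_one] at h
    exact h
  have Wi_W : WInvM q N * (1 + lam q • (omegaM q N * JM q N)) = 1 := by
    have h := mapMatrix_toDiff_eq (Rel.Winv_W (q := q) (N := N))
    simp only [map_mul, map_add, map_smul, map_one] at h
    exact h
  refine ⟨⟨RA_mul_RAInv _ _ hq, RAInv_mul_RA _ _ hq, RA_eq _ _ hq, ?_, ?_, ?_, ?_, ?_, ?_, ?_, ?_,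
    ?_, ?_, ?_, ?_⟩, l_li, li_l, W_Wi, Wi_W, hq⟩
  · simpa only [map_mul, map_neg, mapMatrix_sp2, mapMatrix_RA, mapMatrix_RAInv,
      omegaM] using
      mapMatrix_toDiff_eq (Rel.omega_omega (q := q) (N := N))
  · simpa only [map_mul, map_neg, mapMatrix_sp2, mapMatrix_RA, mapMatrix_RAInv,
      omegaM, LM] using
      mapMatrix_toDiff_eq (Rel.omega_L (q := q) (N := N))
  · simpa only [map_mul, map_add, map_neg, mapMatrix_sp2, mapMatrix_RA, mapMatrix_RAInv,
      omegaM, JM] using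
      mapMatrix_toDiff_eq (Rel.omega_J (q := q) (N := N))
  · simpa only [map_mul, map_neg, mapMatrix_sp2, mapMatrix_RA, mapMatrix_RAInv,
      LM] using
      mapMatrix_toDiff_eq (Rel.L_L (q := q) (N := N))
  · simpa only [map_mul, map_neg, mapMatrix_sp2, mapMatrix_RA, mapMatrix_RAInv,
      JM, LM] using
      mapMatrix_toDiff_eq (Rel.J_L (q := q) (N := N))
  · simpa only [map_mul, map_neg, mapMatrix_sp2, mapMatrix_RA, mapMatrix_RAInv,
      JM] using
      mapMatrix_toDiff_eq (Rel.J_J (q := q) (N := N))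
  · rw [← sp2_mul, l_li, sp2_one]
  · rw [← sp2_mul, li_l, sp2_one]
  · rw [sp2_one_add_smul, sp2_mul]
  · rw [sp2_one_add_smul, sp2_mul]
  · rw [← sp2_mul, W_Wi, sp2_one]
  · rw [← sp2_mul, Wi_W, sp2_one]

end QuantumGL

theorem mainTheorem5 {k : Type*} [Field k] (q : k) (N : ℕ)
    (hq : q ≠ 0) (hq1 : q ^ 2 ≠ 1) (hq2 : q ^ 2 ≠ -1) :
    -- the two expressions for the Laplacian
    laplacian q N = (lam q ^ 2)⁻¹ •
        qTr q (LM q N - 2 + LInvM q N * WBarM q N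
          - lam q • (JM q N * LInvM q N * WBarM q N * omegaM q N)) ∧
    laplacian q N = (lam q ^ 2)⁻¹ •
        qTr q (LM q N + q ^ (2 * N) • UM q N - 2) ∧
    -- the Laplacian is BRST and anti-BRST invariant
    brst q N * laplacian q N - laplacian q N * brst q N = 0 ∧
    antiBrst q N * laplacian q N - laplacian q N * antiBrst q N = 0 ∧
    -- `U = - q^{-2N} [Tr_q(Θ*), ω]_+`
    (∀ i j : Fin N, UM q N i j = -((q ^ (2 * N))⁻¹ •
        (qTr q (ThetaStarM q N) * omegaM q N i j
          + omegaM q N i j * qTr q (ThetaStarM q N)))) ∧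
    -- the reflection equation for `U`
    RAInv (DiffAlg q N) q N * sp2 (UM q N) * RAInv (DiffAlg q N) q N * sp2 (UM q N)
      = sp2 (UM q N) * RAInv (DiffAlg q N) q N * sp2 (UM q N) * RAInv (DiffAlg q N) q N ∧
    -- the commutation relations of `U` with `ω` and `J`
    RA (DiffAlg q N) q N * sp2 (UM q N) * RAInv (DiffAlg q N) q N * sp2 (omegaM q N)
      = sp2 (omegaM q N) * RAInv (DiffAlg q N) q N * sp2 (UM q N) * RA (DiffAlg q N) q N ∧
    RAInv (DiffAlg q N) q N * sp2 (UM q N) * RA (DiffAlg q N) q N * sp2 (JM q N)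
      = sp2 (JM q N) * RA (DiffAlg q N) q N * sp2 (UM q N) * RAInv (DiffAlg q N) q N := by
  have D := diffRel N hq
  have hl : lam q ≠ 0 := by
    intro h
    rw [lam, sub_eq_zero] at h
    apply hq1
    rw [pow_two]
    nth_rw 2 [h]
    exact mul_inv_cancel₀ hq
  have hQ : brst q N = _ := D.brst_eq hl
  have hQs : antiBrst q N = _ := qTr_antiBrst_eq hl
  have hsq := D.theta_sub_sq hq2
  have hsq' := D.thetaStar_sub_sq hq2
  have hQQ : brst q N * brst q N = 0 := by
    rw [hQ, smul_mul_smul_comm, hsq, smul_zero]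
  have hQsQs : antiBrst q N * antiBrst q N = 0 := by
    rw [hQs, smul_mul_smul_comm, hsq', smul_zero]
  have hL := D.laplacian_eq_trace
  have hΔ : laplacian q N = (lam q ^ 2)⁻¹ • (qTr q (LM q N - 2)
      - (qTr q (omegaM q N) * qTr q (ThetaStarM q N)
        + qTr q (ThetaStarM q N) * qTr q (omegaM q N))) := by
    rw [laplacian, hQ, hQs, smul_mul_smul_comm, smul_mul_smul_comm, ← smul_add, hL, ← mul_inv,
      ← pow_two]
    rfl
  -- The same anticommutator is evaluated twice: `hA` yields the first formula for Δ, `hB` the one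
  -- containing U.
  have hA := congrArg (qTr q) D.trw_s
  have hB := congrArg (qTr q) D.trs_w
  rw [qTr_add, qTr_diagonal_mul, qTr_mul_diagonal, qTr_neg] at hA hB
  rw [add_comm] at hB
  change qTr q (omegaM q N) * qTr q (ThetaStarM q N)
    + qTr q (ThetaStarM q N) * qTr q (omegaM q N) = _ at hA hB
  refine ⟨?_, ?_, ?_, ?_, ?_, ?_, ?_, ?_⟩
  · rw [hΔ, hA, sub_neg_eq_add, ← qTr_add, ← add_sub_assoc]
    rfl
  · rw [hΔ, hB, sub_neg_eq_add, ← qTr_add, sub_add_eq_add_sub]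
    rfl
  · rw [laplacian, mul_add, add_mul, ← mul_assoc, hQQ, zero_mul, zero_add, mul_assoc (antiBrst q N),
      hQQ, mul_zero, add_zero, mul_assoc, sub_self]
  · rw [laplacian, mul_add, add_mul, ← mul_assoc (antiBrst q N) (antiBrst q N), hQsQs, zero_mul,
      add_zero, mul_assoc (brst q N), hQsQs, mul_zero, zero_add, mul_assoc, sub_self]
  · intro i j
    have h := congrArg (fun X => -((q ^ (2 * N))⁻¹ • X i j)) D.trs_w
    simp only [Matrix.add_apply, Matrix.diagonal_mul, Matrix.mul_diagonal, Matrix.neg_apply,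
      Matrix.smul_apply, smul_neg, neg_neg, inv_smul_smul₀ (pow_ne_zero (2 * N) hq)] at h
    exact h.symm
  · have h := D.hecke.U_U
    simp only [← sp2_mul] at h
    exact h
  · have h := D.hecke.U_w
    simp only [← sp2_mul] at h
    exact h
  · have h := D.hecke.U_j
    simp only [← sp2_mul] at h
    exact h
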